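/- Let $\mathbb D=\{z\in\mathbb C:|z|<1\}$ and $\bar{\mathbb D}=\{z\in\mathbb C:|z|\le 1\}$, and let $A(\bar{\mathbb D})$ be the disk algebra, i.e. the algebra of all continuous functions $f:\bar{\mathbb D}\to\mathbb C$ that are analytic on $\mathbb D$, with the metric induced by the supremum norm on $\bar{\mathbb D}$. A Möbius transformation on $\bar{\mathbb D}$ is a map of $\bar{\mathbb D}$ onto itself of the form $z\mapsto (az+b)/(cz+d)$ with $a,b,c,d\in\mathbb C$, $ad-bc\neq 0$ and $cz+d\ne 0$ on $\bar{\mathbb D}$. Suppose that $U$ is a surjective isometry (not assumed to be linear) from $A(\bar{\mathbb D})$ onto itself. Then there exist a Möbius transformation $\varphi$ on $\bar{\mathbb D}$ and a constant $\alpha\in\mathbb C$ with $|\alpha|=1$ such that \[ U(f)=U(0)+\alpha\, f\circ\varphi\quad\text{for all } f\in A(\bar{\mathbb D}), \] or \[ U(f)=U(0)+\alpha\,\overline{f\circ\bar\varphi}\quad\text{for all } f\in A(\bar{\mathbb D}), \] where $\bar\varphi(z)=\overline{\varphi(z)}$. Conversely, if a map $U:A(\bar{\mathbb D})\to A(\bar{\mathbb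 D})$ satisfies one of these two equations for some Möbius transformation $\varphi$ on $\bar{\mathbb D}$ and some unimodular constant $\alpha$, then $U$ is a surjective isometry. Moreover, for every $u\in A(\bar{\mathbb D})$, every such $\varphi$ and every such $\alpha$, the formulas $f\mapsto u+\alpha f\circ\varphi$ and $f\mapsto u+\alpha\overline{f\circ\bar\varphi}$ define maps from $A(\bar{\mathbb D})$ to itself. -/

import Mathlib

/-- The closed unit disk, as a compact metric space. -/
abbrev ClosedDisk : Type := Metric.closedBall (0 : ℂ) 1

/-- The disk algebra: the algebra of all continuous functions on the closed unit disk that are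
holomorphic on the open unit disk. Its metric is inherited from the supremum metric of
`C(ClosedDisk, ℂ)`. A function on the closed disk is regarded as holomorphic on the open disk when
it is the restriction of some `F : ℂ → ℂ` that is differentiable on the open disk (the values of `F`
outside the closed disk play no role). -/
def diskAlgebra : Subalgebra ℂ C(ClosedDisk, ℂ) where
  carrier := {f | ∃ F : ℂ → ℂ, DifferentiableOn ℂ F (Metric.ball 0 1) ∧
    ∀ z : ClosedDisk, f z = F z}
  mul_mem' := by
    rintro f g ⟨F, hF, hf⟩ ⟨G, hG, hg⟩
    exact ⟨F * G, hF.mul hG, fun z => by simp [hf, hg]⟩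
  add_mem' := by
    rintro f g ⟨F, hF, hf⟩ ⟨G, hG, hg⟩
    exact ⟨F + G, hF.add hG, fun z => by simp [hf, hg]⟩
  algebraMap_mem' := fun c =>
    ⟨fun _ => c, differentiableOn_const c, fun z => by simp⟩

/-- A Möbius transformation of the closed unit disk: a nondegenerate fractional linear
transformation, without pole in the closed disk, that maps the closed disk onto itself. -/
def IsMobiusOfDisk (φ : ClosedDisk → ClosedDisk) : Prop :=
  Function.Surjective φ ∧ ∃ a b c d : ℂ, a * d - b * c ≠ 0 ∧
    ∀ z : ClosedDisk, c * (z : ℂ) + d ≠ 0 ∧ (φ z : ℂ) = (a * z + b) / (c * z + d)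

/-- Complex conjugation as a map of the closed unit disk to itself. -/
def conjDisk (z : ClosedDisk) : ClosedDisk :=
  ⟨starRingEnd ℂ (z : ℂ), by
    have h := z.2
    rw [mem_closedBall_zero_iff] at h ⊢
    rwa [RCLike.norm_conj]⟩

namespace DiskAlgebra

open Metric

/-- The element of the disk algebra given by a function on `ℂ` that is continuous on the closed
disk and holomorphic on the open disk. -/
def ofFun (F : ℂ → ℂ) (hc : ContinuousOn F (closedBall 0 1))
    (hd : DifferentiableOn ℂ F (ball 0 1)) : diskAlgebra :=
  ⟨⟨fun z => F z, hc.domRestrict⟩, F, hd, fun _ => rfl⟩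

@[simp] theorem ofFun_apply (F : ℂ → ℂ) (hc : ContinuousOn F (closedBall 0 1))
    (hd : DifferentiableOn ℂ F (ball 0 1)) (z : ClosedDisk) : (ofFun F hc hd).1 z = F z := rfl

/-- The identity function as an element of the disk algebra. -/
def coord : diskAlgebra := ofFun id continuousOn_id differentiableOn_id

@[simp] theorem coord_apply (z : ClosedDisk) : coord.1 z = z := rfl

@[simp] theorem add_apply (f g : diskAlgebra) (z : ClosedDisk) :
    (f + g).1 z = f.1 z + g.1 z := rfl

@[simp] theorem sub_apply (f g : diskAlgebra) (z : ClosedDisk) :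
    (f - g).1 z = f.1 z - g.1 z := rfl

@[simp] theorem neg_apply (f : diskAlgebra) (z : ClosedDisk) : (-f).1 z = -f.1 z := rfl

@[simp] theorem mul_apply (f g : diskAlgebra) (z : ClosedDisk) :
    (f * g).1 z = f.1 z * g.1 z := rfl

@[simp] theorem smul_apply (c : ℂ) (f : diskAlgebra) (z : ClosedDisk) :
    (c • f).1 z = c * f.1 z := rfl

@[simp] theorem real_smul_apply (t : ℝ) (f : diskAlgebra) (z : ClosedDisk) :
    (t • f).1 z = t * f.1 z := rfl

@[simp] theorem one_apply (z : ClosedDisk) : (1 : diskAlgebra).1 z = 1 := rfl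

@[simp] theorem zero_apply (z : ClosedDisk) : (0 : diskAlgebra).1 z = 0 := rfl

theorem ext_apply {f g : diskAlgebra} (h : ∀ z, f.1 z = g.1 z) : f = g :=
  Subtype.ext (ContinuousMap.ext h)

theorem norm_apply_le (f : diskAlgebra) (z : ClosedDisk) : ‖f.1 z‖ ≤ ‖f‖ :=
  ContinuousMap.norm_coe_le_norm f.1 z

theorem norm_le_of_apply {f : diskAlgebra} {C : ℝ} (hC : 0 ≤ C) (h : ∀ z, ‖f.1 z‖ ≤ C) :
    ‖f‖ ≤ C :=
  (ContinuousMap.norm_le f.1 hC).2 h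

theorem norm_le_one (z : ClosedDisk) : ‖(z : ℂ)‖ ≤ 1 := mem_closedBall_zero_iff.1 z.2

/-- Every element of the disk algebra comes from a function on `ℂ` that is continuous on the closed
disk. -/
theorem exists_extension (f : diskAlgebra) : ∃ F : ℂ → ℂ, ContinuousOn F (closedBall 0 1) ∧
    DifferentiableOn ℂ F (ball 0 1) ∧ ∀ z : ClosedDisk, f.1 z = F z := by
  obtain ⟨F, hF, hf⟩ := f.2
  refine ⟨F, ?_, hF, hf⟩
  rw [continuousOn_iff_continuous_domRestrict]
  exact f.1.continuous.congr hf

theorem exists_diffContOnCl (f : diskAlgebra) :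
    ∃ F : ℂ → ℂ, DiffContOnCl ℂ F (ball 0 1) ∧ ∀ z : ClosedDisk, f.1 z = F z := by
  obtain ⟨F, hc, hd, hF⟩ := exists_extension f
  exact ⟨F, ⟨hd, by rwa [closure_ball _ one_ne_zero]⟩, hF⟩

/-- The maximum modulus of an element of the disk algebra is attained on the unit circle. -/
theorem exists_norm_eq (f : diskAlgebra) : ∃ y : ClosedDisk, ‖(y : ℂ)‖ = 1 ∧ ‖f.1 y‖ = ‖f‖ := by
  obtain ⟨F, hF, hf⟩ := exists_diffContOnCl f
  obtain ⟨y, hy, hmax⟩ := Complex.exists_mem_frontier_isMaxOn_norm isBounded_ball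
    ⟨0, mem_ball_self one_pos⟩ hF
  rw [frontier_ball _ one_ne_zero, mem_sphere_zero_iff_norm] at hy
  refine ⟨⟨y, mem_closedBall_zero_iff.2 hy.le⟩, hy, le_antisymm (norm_apply_le _ _) ?_⟩
  refine norm_le_of_apply (norm_nonneg _) fun z => ?_
  rw [hf, hf]
  exact hmax (by rw [closure_ball _ one_ne_zero]; exact z.2)

theorem norm_le_of_circle {f : diskAlgebra} {C : ℝ}
    (h : ∀ y : ClosedDisk, ‖(y : ℂ)‖ = 1 → ‖f.1 y‖ ≤ C) (z : ClosedDisk) : ‖f.1 z‖ ≤ C := by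
  obtain ⟨y, hy, hfy⟩ := exists_norm_eq f
  exact (norm_apply_le f z).trans (hfy ▸ h y hy)

/-- Elements of the disk algebra that agree on the unit circle are equal. -/
theorem ext_circle {f g : diskAlgebra}
    (h : ∀ y : ClosedDisk, ‖(y : ℂ)‖ = 1 → f.1 y = g.1 y) : f = g := by
  refine ext_apply fun z => sub_eq_zero.1 (norm_le_zero_iff.1 ?_)
  exact norm_le_of_circle (f := f - g) (C := 0) (fun y hy => by simp [h y hy]) z

/-- The strict maximum principle. -/
theorem eq_const_of_interior_max {f : diskAlgebra} {z₀ : ClosedDisk} (hz₀ : ‖(z₀ : ℂ)‖ < 1)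
    (h : ∀ z, ‖f.1 z‖ ≤ ‖f.1 z₀‖) (z : ClosedDisk) : f.1 z = f.1 z₀ := by
  obtain ⟨F, hF, hf⟩ := exists_diffContOnCl f
  have := Complex.eqOn_closure_of_isPreconnected_of_isMaxOn_norm
    (convex_ball (0 : ℂ) 1).isPreconnected isOpen_ball hF (mem_ball_zero_iff.2 hz₀)
    (fun w hw => by
      have := h ⟨w, ball_subset_closedBall hw⟩
      rwa [hf, hf] at this)
  rw [hf, hf]
  exact this (by rw [closure_ball _ one_ne_zero]; exact z.2)

instance : NoZeroDivisors diskAlgebra where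
  eq_zero_or_eq_zero_of_mul_eq_zero := by
    intro f g hfg
    obtain ⟨F, hF, hf⟩ := exists_diffContOnCl f
    obtain ⟨G, hG, hg⟩ := exists_diffContOnCl g
    have key : ∀ {k : diskAlgebra} {K : ℂ → ℂ}, DiffContOnCl ℂ K (ball 0 1) →
        (∀ z : ClosedDisk, k.1 z = K z) → (∀ z ∈ ball (0 : ℂ) 1, K z = 0) → k = 0 := by
      intro k K hK hk h0
      refine ext_apply fun z => ?_
      have : Set.EqOn K (fun _ => 0) (closure (ball 0 1)) :=
        Set.EqOn.of_subset_closure h0 hK.continuousOn continuousOn_const subset_closure subset_rfl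
      rw [hk]
      exact this (by rw [closure_ball _ one_ne_zero]; exact z.2)
    have hmul : ∀ z ∈ ball (0 : ℂ) 1, F z * G z = 0 := fun z hz => by
      have := congrArg (fun k : diskAlgebra => k.1 ⟨z, ball_subset_closedBall hz⟩) hfg
      simpa only [mul_apply, hf, hg, zero_apply] using this
    exact (AnalyticOnNhd.eq_zero_or_eq_zero_of_mul_eq_zero
      (hF.differentiableOn.analyticOnNhd isOpen_ball)
      (hG.differentiableOn.analyticOnNhd isOpen_ball) hmul
      (convex_ball (0 : ℂ) 1).isPreconnected).imp (key hF hf) (key hG hg)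

theorem exists_mul_eq_one {f : diskAlgebra} (h : ∀ z, f.1 z ≠ 0) :
    ∃ g : diskAlgebra, f * g = 1 := by
  obtain ⟨F, hc, hd, hf⟩ := exists_extension f
  have h0 : ∀ z ∈ closedBall (0 : ℂ) 1, F z ≠ 0 := fun z hz => hf ⟨z, hz⟩ ▸ h ⟨z, hz⟩
  refine ⟨ofFun (fun z => (F z)⁻¹) (hc.inv₀ h0)
    (hd.inv fun z hz => h0 z (ball_subset_closedBall hz)), ext_apply fun z => ?_⟩
  simp [hf, mul_inv_cancel₀ (h0 z z.2)]

/-- Division by a linear factor with root in the open disk. -/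
theorem exists_factor {f : diskAlgebra} {z₀ : ClosedDisk} (hz₀ : ‖(z₀ : ℂ)‖ < 1)
    (h : f.1 z₀ = 0) : ∃ g : diskAlgebra, f = (coord - (z₀ : ℂ) • 1) * g := by
  obtain ⟨F, hc, hd, hf⟩ := exists_extension f
  have hb : ball (0 : ℂ) 1 ∈ nhds (z₀ : ℂ) := isOpen_ball.mem_nhds (mem_ball_zero_iff.2 hz₀)
  refine ⟨ofFun (dslope F z₀)
    ((continuousOn_dslope (Filter.mem_of_superset hb ball_subset_closedBall)).2
      ⟨hc, hd.differentiableAt hb⟩)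
    ((Complex.differentiableOn_dslope hb).2 hd), ext_apply fun z => ?_⟩
  have := sub_smul_dslope F (z₀ : ℂ) z
  rw [← hf, ← hf, h, sub_zero, smul_eq_mul] at this
  simp [this]

/-- An invertible element of the disk algebra that is unimodular on the circle is constant. -/
theorem eq_const_of_unimodular {u w : diskAlgebra} (huw : u * w = 1)
    (hu : ∀ y : ClosedDisk, ‖(y : ℂ)‖ = 1 → ‖u.1 y‖ = 1) :
    ∃ α : ℂ, ‖α‖ = 1 ∧ ∀ z, u.1 z = α := by
  have hval : ∀ z, ‖u.1 z‖ * ‖w.1 z‖ = 1 := fun z => by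
    rw [← norm_mul, ← mul_apply, huw]; simp
  have hu1 := norm_le_of_circle (fun y hy => (hu y hy).le)
  have hw1 := norm_le_of_circle (f := w) (C := 1) (fun y hy => by
    have := hval y
    rw [hu y hy, one_mul] at this
    exact this.le)
  have h0 : ‖u.1 ⟨0, by simp⟩‖ = 1 := by
    have h1 := hu1 ⟨0, by simp⟩
    have h2 := hw1 ⟨0, by simp⟩
    have h3 := hval ⟨0, by simp⟩
    nlinarith [norm_nonneg (u.1 ⟨0, by simp⟩), norm_nonneg (w.1 ⟨0, by simp⟩)]
  exact ⟨_, h0, eq_const_of_interior_max (by simp) (by rw [h0]; exact hu1)⟩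

/-- The disk algebra is stable under composition with its nonconstant elements of norm at most
one. -/
theorem exists_comp {h : diskAlgebra} {φ : ClosedDisk → ClosedDisk} (hφ : ∀ z, h.1 z = φ z)
    (hne : ∀ c : ClosedDisk, ∃ z, φ z ≠ c) (f : diskAlgebra) :
    ∃ g : diskAlgebra, ∀ z, g.1 z = f.1 (φ z) := by
  obtain ⟨F, hc, hd, hf⟩ := exists_extension f
  obtain ⟨H, hHc, hHd, hH⟩ := exists_extension h
  have hHφ : ∀ z : ClosedDisk, H z = φ z := fun z => (hH z).symm.trans (hφ z)
  have hmaps : Set.MapsTo H (closedBall 0 1) (closedBall 0 1) := fun z hz => by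
    rw [hHφ ⟨z, hz⟩]; exact (φ _).2
  have hball : Set.MapsTo H (ball 0 1) (ball 0 1) := fun z hz => by
    rw [mem_ball_zero_iff]
    refine lt_of_le_of_ne (mem_closedBall_zero_iff.1 (hmaps (ball_subset_closedBall hz)))
      fun h1 => ?_
    obtain ⟨w, hw⟩ := hne (φ ⟨z, ball_subset_closedBall hz⟩)
    refine hw (Subtype.ext ?_)
    rw [← hφ, ← hφ]
    refine eq_const_of_interior_max (mem_ball_zero_iff.1 hz) (fun v => ?_) w
    rw [hH ⟨z, _⟩, h1, hφ]
    exact norm_le_one _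
  exact ⟨ofFun (F ∘ H) (hc.comp hHc hmaps) (hd.comp hHd hball), fun z => by simp [hf, hHφ]⟩

/-- The conjugate `z ↦ conj (f (conj z))` of an element of the disk algebra. -/
noncomputable def conj (f : diskAlgebra) : diskAlgebra :=
  ⟨⟨fun z => starRingEnd ℂ (f.1 (conjDisk z)), by
    refine Complex.continuous_conj.comp (f.1.continuous.comp ?_)
    exact (Complex.continuous_conj.comp continuous_subtype_val).subtype_mk _⟩, by
    obtain ⟨F, hd, hf⟩ := f.2
    refine ⟨fun z => starRingEnd ℂ (F (starRingEnd ℂ z)), fun z hz => ?_, fun z => ?_⟩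
    · have hz' : starRingEnd ℂ z ∈ ball (0 : ℂ) 1 := by simpa using hz
      have := (hd.differentiableAt (isOpen_ball.mem_nhds hz')).conj_conj
      rw [Complex.conj_conj] at this
      exact this.differentiableWithinAt
    · exact congrArg (starRingEnd ℂ) (hf _)⟩

@[simp] theorem conj_apply (f : diskAlgebra) (z : ClosedDisk) :
    (conj f).1 z = starRingEnd ℂ (f.1 (conjDisk z)) := rfl

@[simp] theorem conjDisk_conjDisk (z : ClosedDisk) : conjDisk (conjDisk z) = z :=
  Subtype.ext (Complex.conj_conj _)

@[simp] theorem conj_conj (f : diskAlgebra) : conj (conj f) = f :=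
  ext_apply fun z => by simp

end DiskAlgebra

namespace DiskAlgebra

open Metric

open scoped ComplexConjugate

/-- The function `z ↦ (1 + x̄ z) / 2`, which peaks at the point `x` of the unit circle. -/
noncomputable def peak (x : ClosedDisk) : diskAlgebra :=
  (1 / 2 : ℂ) • (1 + conj (x : ℂ) • coord)

theorem peak_apply (x z : ClosedDisk) : (peak x).1 z = 1 / 2 * (1 + conj (x : ℂ) * z) := rfl

theorem conj_mul_self_of_norm_one {x : ℂ} (hx : ‖x‖ = 1) : conj x * x = 1 := by
  rw [Complex.conj_mul', hx]; simp

@[simp] theorem peak_self {x : ClosedDisk} (hx : ‖(x : ℂ)‖ = 1) : (peak x).1 x = 1 := by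
  rw [peak_apply, conj_mul_self_of_norm_one hx]; norm_num

theorem norm_peak_le (x z : ClosedDisk) : ‖(peak x).1 z‖ ≤ 1 := by
  have h : ‖conj (x : ℂ) * z‖ ≤ 1 := by
    rw [norm_mul, RCLike.norm_conj]
    exact mul_le_one₀ (norm_le_one x) (norm_nonneg _) (norm_le_one z)
  calc ‖(peak x).1 z‖ = 1 / 2 * ‖1 + conj (x : ℂ) * z‖ := by rw [peak_apply, norm_mul]; norm_num
    _ ≤ 1 / 2 * (‖(1 : ℂ)‖ + ‖conj (x : ℂ) * z‖) := by gcongr; exact norm_add_le _ _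
    _ ≤ 1 := by rw [norm_one]; linarith

theorem eq_of_norm_peak_eq_one {x z : ClosedDisk} (hx : ‖(x : ℂ)‖ = 1)
    (h : ‖(peak x).1 z‖ = 1) : z = x := by
  have h1 : ‖conj (x : ℂ) * z‖ ≤ 1 := by
    rw [norm_mul, RCLike.norm_conj, hx, one_mul]; exact norm_le_one z
  have h2 : ‖1 + conj (x : ℂ) * z‖ = 2 := by
    rw [peak_apply, norm_mul] at h; norm_num at h; linarith
  have hw : conj (x : ℂ) * z = 1 := by
    generalize conj (x : ℂ) * z = w at h1 h2
    have h1' : w.re ^ 2 + w.im ^ 2 ≤ 1 := by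
      have := pow_le_one₀ (n := 2) (norm_nonneg _) h1
      rw [Complex.sq_norm, Complex.normSq_apply] at this
      linarith
    have h2' : (1 + w.re) ^ 2 + w.im ^ 2 = 4 := by
      have := congrArg (· ^ 2) h2
      simp only [Complex.sq_norm, Complex.normSq_apply] at this
      norm_num at this
      linarith
    have hre : w.re = 1 := by nlinarith
    have him : w.im = 0 := by nlinarith
    exact Complex.ext hre him
  refine Subtype.ext ?_
  calc (z : ℂ) = (conj (x : ℂ) * x) * z := by rw [conj_mul_self_of_norm_one hx, one_mul]
    _ = x * (conj (x : ℂ) * z) := by ring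
    _ = x := by rw [hw, mul_one]

/-- A contractive functional attaining its norm at a rotated peak function is at most zero on
functions that vanish at the peak. -/
theorem functional_nonpos {ℓ : diskAlgebra →ₗ[ℝ] ℝ} (hℓ : ∀ f, ℓ f ≤ ‖f‖) {x : ClosedDisk}
    (hx : ‖(x : ℂ)‖ = 1) {c : ℂ} (hc : ‖c‖ = 1) (h1 : ℓ (c • peak x) = 1) {g : diskAlgebra}
    (hg : g.1 x = 0) : ℓ g ≤ 0 := by
  refine le_of_forall_pos_le_add fun ε hε => ?_
  obtain ⟨r, hr, hfar⟩ : ∃ r < 1, ∀ z, ε ≤ ‖g.1 z‖ → ‖(peak x).1 z‖ ≤ r := by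
    have hK : IsCompact {z | ε ≤ ‖g.1 z‖} :=
      (isClosed_le continuous_const g.1.continuous.norm).isCompact
    rcases Set.eq_empty_or_nonempty {z | ε ≤ ‖g.1 z‖} with he | hne
    · exact ⟨0, one_pos, fun z hz => absurd (show z ∈ {z | ε ≤ ‖g.1 z‖} from hz) (by simp [he])⟩
    · obtain ⟨z₁, hz₁, hmax⟩ := hK.exists_isMaxOn hne (peak x).1.continuous.norm.continuousOn
      refine ⟨_, lt_of_le_of_ne (norm_peak_le x z₁) fun h => ?_, fun z hz => hmax hz⟩
      have hz₁' : ε ≤ ‖g.1 z₁‖ := hz₁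
      rw [eq_of_norm_peak_eq_one hx h, hg, norm_zero] at hz₁'
      linarith
  set t : ℝ := ‖g‖ / (1 - r) with ht
  have ht0 : 0 ≤ t := div_nonneg (norm_nonneg _) (by linarith)
  have htg : t * (1 - r) = ‖g‖ := div_mul_cancel₀ _ (by linarith)
  have hbound : ‖g + t • (c • peak x)‖ ≤ t + ε := by
    refine norm_le_of_apply (by linarith) fun z => ?_
    have hle : ‖(g + t • (c • peak x)).1 z‖ ≤ ‖g.1 z‖ + t * ‖(peak x).1 z‖ := by
      refine (norm_add_le _ _).trans (le_of_eq ?_)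
      rw [real_smul_apply, smul_apply, norm_mul, norm_mul, hc, one_mul, Complex.norm_real,
        Real.norm_of_nonneg ht0]
    rcases lt_or_ge ‖g.1 z‖ ε with hz | hz
    · nlinarith [norm_peak_le x z]
    · nlinarith [hfar z hz, norm_apply_le g z]
  have := hℓ (g + t • (c • peak x))
  rw [map_add, map_smul, h1, smul_eq_mul, mul_one] at this
  linarith

/-- A contractive functional attaining its norm at a rotated peak function is a rotated
evaluation. -/
theorem functional_eq {ℓ : diskAlgebra →ₗ[ℝ] ℝ} (hℓ : ∀ f, ℓ f ≤ ‖f‖) {x : ClosedDisk}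
    (hx : ‖(x : ℂ)‖ = 1) {c : ℂ} (hc : ‖c‖ = 1) (h1 : ℓ (c • peak x) = 1) (f : diskAlgebra) :
    ℓ f = (conj c * f.1 x).re := by
  have hzero : ∀ g : diskAlgebra, g.1 x = 0 → ℓ g = 0 := fun g hg => by
    refine le_antisymm (functional_nonpos hℓ hx hc h1 hg) ?_
    have := functional_nonpos hℓ hx hc h1 (g := -g) (by simp [hg])
    rw [map_neg] at this
    linarith
  have hnorm : ∀ w : ℂ, ‖(w * c) • peak x‖ ≤ ‖w‖ := fun w =>
    norm_le_of_apply (norm_nonneg _) fun z => by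
      rw [smul_apply, norm_mul, norm_mul, hc, mul_one]
      exact mul_le_of_le_one_right (norm_nonneg _) (norm_peak_le x z)
  have hlin : ∀ a b : ℝ, ℓ (((a + b * Complex.I : ℂ) * c) • peak x) =
      a + b * ℓ ((Complex.I * c) • peak x) := fun a b => by
    have : ((a + b * Complex.I : ℂ) * c) • peak x =
        a • (c • peak x) + b • ((Complex.I * c) • peak x) :=
      ext_apply fun z => by
        simp only [smul_apply, add_apply, real_smul_apply]; ring
    rw [this, map_add, ℓ.map_smul, ℓ.map_smul, h1, smul_eq_mul, smul_eq_mul, mul_one]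
  have hI : ℓ ((Complex.I * c) • peak x) = 0 := by
    set s := ℓ ((Complex.I * c) • peak x) with hs
    have h := (hℓ _).trans (hnorm ((1 : ℝ) + s * Complex.I))
    rw [hlin] at h
    have h2 : ‖(((1 : ℝ) : ℂ) + s * Complex.I)‖ ^ 2 = 1 + s * s := by
      rw [Complex.sq_norm, Complex.normSq_apply]; simp
    have h3 : (1 + s * s) ^ 2 ≤ 1 + s * s := by
      rw [show (1 + s * s) ^ 2 = (1 + s * s) * (1 + s * s) by ring]
      nlinarith [mul_self_nonneg s, norm_nonneg (((1 : ℝ) : ℂ) + s * Complex.I)]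
    nlinarith [mul_self_nonneg s, mul_self_nonneg (s * s)]
  have hcc : conj c * c = 1 := conj_mul_self_of_norm_one hc
  set w : ℂ := conj c * f.1 x with hw
  have hwc : w * c = f.1 x := by rw [hw, mul_right_comm, hcc, one_mul]
  have hsplit : f = (w * c) • peak x + (f - (w * c) • peak x) := by abel
  have hre := hlin w.re w.im
  rw [Complex.re_add_im, hI, mul_zero, add_zero] at hre
  rw [hsplit, map_add, hre, hzero _ (by simp [peak_self hx, hwc]), add_zero]

/-- A surjective real-linear isometry intertwines the real parts of the rotated evaluations at
points of the circle. -/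
theorem exists_re_eq (T : diskAlgebra ≃ₗᵢ[ℝ] diskAlgebra) {x : ClosedDisk} (hx : ‖(x : ℂ)‖ = 1)
    {c : ℂ} (hc : ‖c‖ = 1) : ∃ (y : ClosedDisk) (μ : ℂ), ‖(y : ℂ)‖ = 1 ∧ ‖μ‖ = 1 ∧
      ∀ f, (conj μ * (T f).1 y).re = (conj c * f.1 x).re := by
  obtain ⟨y, hy, hTy⟩ := exists_norm_eq (T (c • peak x))
  have hpeak : ‖c • peak x‖ = 1 := by
    refine le_antisymm (norm_le_of_apply zero_le_one fun z => ?_) ?_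
    · rw [smul_apply, norm_mul, hc, one_mul]; exact norm_peak_le x z
    · have := norm_apply_le (c • peak x) x
      rwa [smul_apply, norm_mul, hc, one_mul, peak_self hx, norm_one] at this
  rw [T.norm_map, hpeak] at hTy
  set μ := (T (c • peak x)).1 y with hμ
  refine ⟨y, μ, hy, hTy, fun f => ?_⟩
  let ℓ : diskAlgebra →ₗ[ℝ] ℝ :=
    { toFun := fun f => (conj μ * (T f).1 y).re
      map_add' := fun f g => by simp only [map_add, add_apply, mul_add, Complex.add_re]
      map_smul' := fun t f => by
        simp only [map_smul, real_smul_apply, RingHom.id_apply, smul_eq_mul]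
        rw [mul_left_comm, Complex.re_ofReal_mul] }
  refine functional_eq (ℓ := ℓ) (fun f => ?_) hx hc ?_ f
  · calc (conj μ * (T f).1 y).re ≤ ‖conj μ * (T f).1 y‖ := Complex.re_le_norm _
      _ = ‖(T f).1 y‖ := by rw [norm_mul, RCLike.norm_conj, hTy, one_mul]
      _ ≤ ‖f‖ := (norm_apply_le _ _).trans_eq (T.norm_map f)
  · change (conj μ * (T (c • peak x)).1 y).re = 1
    rw [← hμ, conj_mul_self_of_norm_one hTy, Complex.one_re]

end DiskAlgebra

namespace DiskAlgebra

open Metric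

open scoped ComplexConjugate

theorem eq_zero_of_forall_re_mul {w : ℂ} (h : ∀ c : ℂ, (w * c).re = 0) : w = 0 := by
  have := h (conj w)
  rw [Complex.mul_conj, Complex.ofReal_re] at this
  exact Complex.normSq_eq_zero.1 this

/-- If two combined rotated evaluations add up to a third one, then the points coincide. -/
theorem eq_of_combination {x₁ x₂ x₃ : ClosedDisk} {c₁ c₂ c₃ : ℂ} (hc₁ : c₁ ≠ 0) (hc₂ : c₂ ≠ 0)
    (h : ∀ f : diskAlgebra, (c₁ * f.1 x₁).re + (c₂ * f.1 x₂).re = (c₃ * f.1 x₃).re) :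
    x₁ = x₂ := by
  by_contra hne
  have hne' : ((x₁ : ℂ) - x₂) ≠ 0 := sub_ne_zero.2 fun h => hne (Subtype.ext h)
  have hne'' : ((x₂ : ℂ) - x₁) ≠ 0 := sub_ne_zero.2 fun h => hne (Subtype.ext h.symm)
  have h1 : c₁ * (((x₁ : ℂ) - x₂) * (x₁ - x₃)) = 0 := eq_zero_of_forall_re_mul fun c => by
    have := h (c • ((coord - (x₂ : ℂ) • 1) * (coord - (x₃ : ℂ) • 1)))
    simp only [smul_apply, mul_apply, sub_apply, coord_apply, one_apply, mul_one, sub_self,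
      mul_zero, zero_mul, Complex.zero_re, add_zero] at this
    rw [← this]; ring_nf
  have h2 : c₂ * (((x₂ : ℂ) - x₁) * (x₂ - x₃)) = 0 := eq_zero_of_forall_re_mul fun c => by
    have := h (c • ((coord - (x₁ : ℂ) • 1) * (coord - (x₃ : ℂ) • 1)))
    simp only [smul_apply, mul_apply, sub_apply, coord_apply, one_apply, mul_one, sub_self,
      mul_zero, zero_mul, Complex.zero_re, zero_add] at this
    rw [← this]; ring_nf
  rw [mul_eq_zero_iff_left hc₁, mul_eq_zero_iff_left hne', sub_eq_zero] at h1
  rw [mul_eq_zero_iff_left hc₂, mul_eq_zero_iff_left hne'', sub_eq_zero] at h2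
  exact hne (Subtype.ext (h1.trans h2.symm))

/-- At each point of the circle, a surjective real-linear isometry is a rotated evaluation or
the conjugate of one. -/
theorem exists_apply_eq (T : diskAlgebra ≃ₗᵢ[ℝ] diskAlgebra) {y : ClosedDisk}
    (hy : ‖(y : ℂ)‖ = 1) : ∃ (x : ClosedDisk) (β : ℂ), ‖(x : ℂ)‖ = 1 ∧ ‖β‖ = 1 ∧
      ((∀ f, (T f).1 y = β * f.1 x) ∨ ∀ f, (T f).1 y = β * conj (f.1 x)) := by
  have key : ∀ μ : ℂ, ‖μ‖ = 1 → ∃ (x : ClosedDisk) (c : ℂ), ‖(x : ℂ)‖ = 1 ∧ ‖c‖ = 1 ∧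
      ∀ f, (conj μ * (T f).1 y).re = (conj c * f.1 x).re := fun μ hμ => by
    obtain ⟨x, c, hx, hc, h⟩ := exists_re_eq T.symm hy hμ
    refine ⟨x, c, hx, hc, fun f => ?_⟩
    rw [← h (T f), T.symm_apply_apply]
  obtain ⟨x, p, hx, hp, h₁⟩ := key 1 (by simp)
  obtain ⟨x₂, q, -, hq, h₂⟩ := key Complex.I (by simp)
  obtain ⟨x₃, r, -, hr, h₃⟩ := key ((3 / 5 : ℝ) + (4 / 5 : ℝ) * Complex.I) (by
    rw [← sq_eq_sq₀ (norm_nonneg _) zero_le_one, Complex.sq_norm, Complex.normSq_add_mul_I]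
    norm_num)
  have hre : ∀ f, ((T f).1 y).re = (conj p * f.1 x).re := fun f => by simpa using h₁ f
  have him : ∀ f, ((T f).1 y).im = (conj q * f.1 x₂).re := fun f => by simpa using h₂ f
  have hcomb : ∀ f : diskAlgebra, (((3 / 5 : ℝ) * conj p) * f.1 x).re +
      (((4 / 5 : ℝ) * conj q) * f.1 x₂).re = (conj r * f.1 x₃).re := fun f => by
    rw [← h₃ f, mul_assoc, Complex.re_ofReal_mul, mul_assoc, Complex.re_ofReal_mul, ← hre, ← him]
    rw [map_add, map_mul, Complex.conj_ofReal, Complex.conj_ofReal, Complex.conj_I, add_mul,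
      mul_assoc, Complex.add_re, Complex.re_ofReal_mul, Complex.re_ofReal_mul]
    simp
  have hnorm : ∀ {w : ℂ}, ‖w‖ = 1 → w.re ^ 2 + w.im ^ 2 = 1 := fun {w} hw => by
    have := congrArg (· ^ 2) hw
    simp only [Complex.sq_norm, Complex.normSq_apply] at this
    linarith
  have hne : ∀ {w : ℂ}, ‖w‖ = 1 → conj w ≠ 0 := fun {w} hw h0 => by
    rw [← RCLike.norm_conj, h0, norm_zero] at hw; exact zero_ne_one hw
  obtain rfl : x = x₂ := eq_of_combination
    (mul_ne_zero (by norm_num) (hne hp)) (mul_ne_zero (by norm_num) (hne hq)) hcomb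
  have e1 : 3 / 5 * p.re + 4 / 5 * q.re = r.re := by
    have := hcomb 1
    simp only [one_apply, mul_one, Complex.re_ofReal_mul, Complex.conj_re] at this
    exact this
  have e2 : 3 / 5 * p.im + 4 / 5 * q.im = r.im := by
    have := hcomb (Complex.I • 1)
    simp only [smul_apply, one_apply, mul_one, mul_assoc, Complex.re_ofReal_mul, Complex.mul_I_re,
      Complex.conj_im, neg_neg] at this
    exact this
  have hp' := hnorm hp
  have hq' := hnorm hq
  have hr' := hnorm hr
  have horth : p.re * q.re + p.im * q.im = 0 := by
    rw [← e1, ← e2] at hr'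
    linear_combination 25 / 24 * hr' - 9 / 24 * hp' - 16 / 24 * hq'
  set s := p.re * q.im - p.im * q.re with hs
  have hqre : q.re = -p.im * s := by
    rw [hs]; linear_combination p.re * horth - q.re * hp'
  have hqim : q.im = p.re * s := by
    rw [hs]; linear_combination p.im * horth - q.im * hp'
  have hs2 : (s - 1) * (s + 1) = 0 := by
    have : s ^ 2 + (p.re * q.re + p.im * q.im) ^ 2 =
      (p.re ^ 2 + p.im ^ 2) * (q.re ^ 2 + q.im ^ 2) := by rw [hs]; ring
    rw [hp', hq', horth] at this
    linear_combination this
  rcases mul_eq_zero.1 hs2 with h | h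
  · have hs1 : s = 1 := by linarith
    rw [hs1, mul_one] at hqre hqim
    refine ⟨x, conj p, hx, by rwa [RCLike.norm_conj], Or.inl fun f => Complex.ext (hre f) ?_⟩
    rw [him]
    simp [hqre, hqim]
    ring
  · have hs1 : s = -1 := by linarith
    rw [hs1, mul_neg_one] at hqre hqim
    refine ⟨x, p, hx, hp, Or.inr fun f => Complex.ext ?_ ?_⟩
    · rw [hre]; simp
    · rw [him]
      simp [hqre, hqim]
      ring

/-- A surjective real-linear isometry is a weighted composition operator on the circle, possibly
followed by conjugation. -/
theorem forall_apply_eq (T : diskAlgebra ≃ₗᵢ[ℝ] diskAlgebra) :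
    (∀ y : ClosedDisk, ‖(y : ℂ)‖ = 1 → ∃ (x : ClosedDisk) (β : ℂ), ‖(x : ℂ)‖ = 1 ∧ ‖β‖ = 1 ∧
      ∀ f, (T f).1 y = β * f.1 x) ∨
    (∀ y : ClosedDisk, ‖(y : ℂ)‖ = 1 → ∃ (x : ClosedDisk) (β : ℂ), ‖(x : ℂ)‖ = 1 ∧ ‖β‖ = 1 ∧
      ∀ f, (T f).1 y = β * conj (f.1 x)) := by
  have hprod : (T (Complex.I • 1) - Complex.I • T 1) * (T (Complex.I • 1) + Complex.I • T 1) = 0 :=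
    ext_circle fun y hy => by
      obtain ⟨x, β, -, -, h | h⟩ := exists_apply_eq T hy <;>
      simp only [mul_apply, sub_apply, add_apply, smul_apply, one_apply, zero_apply, h, map_mul,
        map_one, Complex.conj_I] <;> ring
  have hβ0 : ∀ {β : ℂ}, ‖β‖ = 1 → β ≠ 0 := fun {β} hβ h0 => by simp [h0] at hβ
  refine (mul_eq_zero.1 hprod).imp (fun h0 y hy => ?_) (fun h0 y hy => ?_)
  · obtain ⟨x, β, hx, hβ, h | h⟩ := exists_apply_eq T hy
    · exact ⟨x, β, hx, hβ, h⟩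
    · have := congrArg (fun k : diskAlgebra => k.1 y) h0
      simp only [sub_apply, smul_apply, one_apply, zero_apply, h, map_mul, map_one,
        Complex.conj_I] at this
      have h2 : (-2 * Complex.I) * β = 0 := by linear_combination this
      simp [hβ0 hβ] at h2
  · obtain ⟨x, β, hx, hβ, h | h⟩ := exists_apply_eq T hy
    · have := congrArg (fun k : diskAlgebra => k.1 y) h0
      simp only [add_apply, smul_apply, one_apply, zero_apply, h] at this
      have h2 : (2 * Complex.I) * β = 0 := by linear_combination this
      simp [hβ0 hβ] at h2
    · exact ⟨x, β, hx, hβ, h⟩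

end DiskAlgebra

namespace DiskAlgebra

open Metric

open scoped ComplexConjugate

theorem norm_sub_eq_of_norm_one {y z : ℂ} (hy : ‖y‖ = 1) : ‖1 - conj z * y‖ = ‖y - z‖ := by
  have h : conj (1 - conj z * y) * y = y - z := by
    rw [map_sub, map_one, map_mul, Complex.conj_conj, sub_mul, one_mul, mul_assoc,
      conj_mul_self_of_norm_one hy, mul_one]
  rw [← h, norm_mul, RCLike.norm_conj, hy, mul_one]

theorem one_sub_conj_mul_ne_zero {y z : ℂ} (hy : ‖y‖ ≤ 1) (hz : ‖z‖ < 1) :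
    1 - conj z * y ≠ 0 := fun h => by
  have h1 : ‖conj z * y‖ = 1 := by rw [← sub_eq_zero.1 h, norm_one]
  rw [norm_mul, RCLike.norm_conj] at h1
  nlinarith [norm_nonneg z, norm_nonneg y]

/-- A self-map of the disk inducing a surjective composition operator on the disk algebra and
preserving the circle is a Möbius transformation. -/
theorem isMobiusOfDisk_of_comp {h : diskAlgebra} {φ : ClosedDisk → ClosedDisk}
    (hφ : ∀ z, h.1 z = φ z) (hcirc : ∀ y : ClosedDisk, ‖(y : ℂ)‖ = 1 → ‖(φ y : ℂ)‖ = 1)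
    (hcomp : ∀ f : diskAlgebra, ∃ g : diskAlgebra, ∀ z, g.1 z = f.1 (φ z))
    (hsurj : Function.Surjective φ) (hinv : ∃ ψ : diskAlgebra, ∀ z, ψ.1 (φ z) = z) :
    IsMobiusOfDisk φ := by
  refine ⟨hsurj, ?_⟩
  obtain ⟨z₀, hz₀⟩ := hsurj ⟨0, by simp⟩
  have hφ0 : (φ z₀ : ℂ) = 0 := by rw [hz₀]
  have hz₀1 : ‖(z₀ : ℂ)‖ < 1 := lt_of_le_of_ne (norm_le_one z₀) fun h1 => by
    have := hcirc z₀ h1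
    rw [hφ0, norm_zero] at this
    exact zero_ne_one this
  obtain ⟨ψ, hψ⟩ := hinv
  obtain ⟨k₁, hk₁⟩ := exists_factor (f := h) hz₀1 (by rw [hφ, hφ0])
  obtain ⟨k₂, hk₂⟩ := exists_factor (f := ψ - (z₀ : ℂ) • 1) (z₀ := ⟨0, by simp⟩) (by simp)
    (by rw [← hz₀]; simp [hψ])
  obtain ⟨k₃, hk₃⟩ := hcomp k₂
  have hval : ∀ z, (φ z : ℂ) = (z - z₀) * k₁.1 z := fun z => by
    rw [← hφ, hk₁]; simp
  have hval₂ : ∀ z : ClosedDisk, (z - z₀ : ℂ) = φ z * k₃.1 z := fun z => by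
    have := congrArg (fun k : diskAlgebra => k.1 (φ z)) hk₂
    simpa [hψ, ← hk₃] using this
  have hunit : k₁ * k₃ = 1 := by
    have h0 : (coord - (z₀ : ℂ) • 1) * (k₁ * k₃ - 1) = 0 := ext_apply fun z => by
      have := hval₂ z
      rw [hval z] at this
      simp only [mul_apply, sub_apply, smul_apply, coord_apply, one_apply, mul_one, zero_apply]
      linear_combination -this
    refine sub_eq_zero.1 ((mul_eq_zero.1 h0).resolve_left fun h1 => ?_)
    have e1 := congrArg (fun k : diskAlgebra => k.1 ⟨1, by simp⟩) h1
    simp only [sub_apply, smul_apply, coord_apply, one_apply, mul_one, zero_apply] at e1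
    rw [← sub_eq_zero.1 e1, norm_one] at hz₀1
    exact lt_irrefl _ hz₀1
  obtain ⟨e, he⟩ := exists_mul_eq_one (f := 1 - conj (z₀ : ℂ) • coord)
    (fun z => one_sub_conj_mul_ne_zero (norm_le_one z) hz₀1)
  obtain ⟨c, hc, hcval⟩ := eq_const_of_unimodular (u := k₁ * (1 - conj (z₀ : ℂ) • coord))
    (w := k₃ * e) (by rw [mul_mul_mul_comm, hunit, he, one_mul]) (fun y hy => by
      have h1 := hcirc y hy
      rw [hval, norm_mul, ← norm_sub_eq_of_norm_one hy] at h1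
      rw [mul_apply, norm_mul, mul_comm]
      exact h1)
  refine ⟨c, -c * z₀, -conj (z₀ : ℂ), 1, ?_, fun z => ?_⟩
  · have hc0 : c ≠ 0 := fun h0 => by simp [h0] at hc
    have := mul_ne_zero hc0 (one_sub_conj_mul_ne_zero hz₀1.le hz₀1)
    intro h0
    apply this
    linear_combination h0
  · have hne := one_sub_conj_mul_ne_zero (norm_le_one z) hz₀1
    have hne' : -conj (z₀ : ℂ) * z + 1 ≠ 0 := fun h0 => hne (by linear_combination h0)
    refine ⟨hne', ?_⟩
    have h2 : k₁.1 z * (1 - conj (z₀ : ℂ) * z) = c := hcval z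
    rw [eq_div_iff hne', hval z]
    linear_combination ((z : ℂ) - z₀) * h2

/-- A bijection of the disk algebra acting on the circle as a weighted composition operator with
unimodular weight is a rotated composition operator with a Möbius transformation. -/
theorem exists_mobius_of_forall_apply_eq {T : diskAlgebra → diskAlgebra}
    (hT : Function.Bijective T)
    (h : ∀ y : ClosedDisk, ‖(y : ℂ)‖ = 1 → ∃ (x : ClosedDisk) (β : ℂ), ‖(x : ℂ)‖ = 1 ∧ ‖β‖ = 1 ∧
      ∀ f, (T f).1 y = β * f.1 x) :
    ∃ (φ : ClosedDisk → ClosedDisk) (α : ℂ), IsMobiusOfDisk φ ∧ ‖α‖ = 1 ∧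
      ∀ f z, (T f).1 z = α * f.1 (φ z) := by
  obtain ⟨e, he⟩ := hT.2 1
  obtain ⟨α, hα, hαval⟩ := eq_const_of_unimodular (u := T 1) (w := T (e * e))
    (ext_circle fun y hy => by
      obtain ⟨x, β, -, -, hf⟩ := h y hy
      have := congrArg (fun k : diskAlgebra => k.1 y) he
      simp only [hf, one_apply] at this
      simp only [mul_apply, hf, one_apply]
      linear_combination (β * e.1 x + 1) * this)
    (fun y hy => by
      obtain ⟨x, β, -, hβ, hf⟩ := h y hy
      rw [hf, one_apply, mul_one, hβ])
  have hα0 : α ≠ 0 := fun h0 => by simp [h0] at hα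
  have hcirc : ∀ y : ClosedDisk, ‖(y : ℂ)‖ = 1 → ∃ x : ClosedDisk, ‖(x : ℂ)‖ = 1 ∧
      ∀ f, (T f).1 y = α * f.1 x := fun y hy => by
    obtain ⟨x, β, hx, -, hf⟩ := h y hy
    have : β = α := by rw [← hαval y, hf, one_apply, mul_one]
    exact ⟨x, hx, this ▸ hf⟩
  set k : diskAlgebra := α⁻¹ • T coord with hk
  have hkcirc : ∀ {y x : ClosedDisk}, (∀ f, (T f).1 y = α * f.1 x) → k.1 y = x :=
    fun {y x} hf => by
      rw [hk, smul_apply, hf, coord_apply, inv_mul_cancel_left₀ hα0]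
  have hk1 : ∀ z, ‖k.1 z‖ ≤ 1 := norm_le_of_circle fun y hy => by
    obtain ⟨x, hx, hf⟩ := hcirc y hy
    rw [hkcirc hf, hx]
  let φ : ClosedDisk → ClosedDisk := fun z => ⟨k.1 z, mem_closedBall_zero_iff.2 (hk1 z)⟩
  have hkφ : ∀ z, k.1 z = φ z := fun z => rfl
  have hcirc' : ∀ y : ClosedDisk, ‖(y : ℂ)‖ = 1 → ‖(φ y : ℂ)‖ = 1 ∧
      ∀ f, (T f).1 y = α * f.1 (φ y) := fun y hy => by
    obtain ⟨x, hx, hf⟩ := hcirc y hy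
    have : φ y = x := Subtype.ext (hkcirc hf)
    rw [this]
    exact ⟨hx, hf⟩
  have hne : ∀ c : ClosedDisk, ∃ z, φ z ≠ c := by
    intro c
    by_contra! hall
    have : T coord = T ((c : ℂ) • 1) := ext_circle fun y hy => by
      rw [(hcirc' y hy).2, (hcirc' y hy).2, hall]; simp
    have hc := hT.1 this
    have e0 := congrArg (fun k : diskAlgebra => k.1 ⟨0, by simp⟩) hc
    have e1 := congrArg (fun k : diskAlgebra => k.1 ⟨1, by simp⟩) hc
    simp only [coord_apply, smul_apply, one_apply] at e0 e1
    exact zero_ne_one (e0.trans e1.symm)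
  have hcomp := exists_comp hkφ hne
  have hform : ∀ f z, (T f).1 z = α * f.1 (φ z) := fun f z => by
    obtain ⟨g, hg⟩ := hcomp f
    have : T f = α • g := ext_circle fun y hy => by
      rw [(hcirc' y hy).2, smul_apply, hg]
    rw [this, smul_apply, hg]
  have hsurj : Function.Surjective φ := by
    intro w
    by_contra! hw
    obtain ⟨g, hg⟩ := exists_mul_eq_one (f := k - (w : ℂ) • 1) (fun z h0 => hw z (Subtype.ext (by
      rw [← hkφ]
      simpa [sub_eq_zero] using h0)))
    obtain ⟨f, rfl⟩ := hT.2 g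
    have : T ((coord - (w : ℂ) • 1) * (α • f)) = T 1 := ext_apply fun z => by
      have := congrArg (fun k : diskAlgebra => k.1 z) hg
      simp only [mul_apply, sub_apply, smul_apply, one_apply, mul_one, hform, hkφ] at this
      simp only [hform, mul_apply, sub_apply, smul_apply, coord_apply, one_apply, mul_one]
      linear_combination α * this
    have := congrArg (fun k : diskAlgebra => k.1 w) (hT.1 this)
    simp at this
  obtain ⟨ψ, hψ⟩ := hT.2 (α • coord)
  refine ⟨φ, α, isMobiusOfDisk_of_comp hkφ (fun y hy => (hcirc' y hy).1) hcomp hsurj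
    ⟨ψ, fun z => ?_⟩, hα, hform⟩
  have := hform ψ z
  rw [hψ, smul_apply, coord_apply] at this
  exact (mul_left_cancel₀ hα0 this).symm

end DiskAlgebra

namespace IsMobiusOfDisk

open DiskAlgebra

/-- Composition with a Möbius transformation of the disk preserves the disk algebra. -/
theorem exists_comp {φ : ClosedDisk → ClosedDisk} (hφ : IsMobiusOfDisk φ) (f : diskAlgebra) :
    ∃ g : diskAlgebra, ∀ z, g.1 z = f.1 (φ z) := by
  obtain ⟨hsurj, a, b, c, d, -, h⟩ := hφ
  have hne : ∀ z ∈ Metric.closedBall (0 : ℂ) 1, c * z + d ≠ 0 := fun z hz => (h ⟨z, hz⟩).1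
  refine DiskAlgebra.exists_comp
    (h := ofFun (fun z => (a * z + b) / (c * z + d)) ?_ ?_) (fun z => (h z).2.symm) ?_ f
  · exact ContinuousOn.div (by fun_prop) (by fun_prop) hne
  · exact DifferentiableOn.div (by fun_prop) (by fun_prop)
      fun z hz => hne z (Metric.ball_subset_closedBall hz)
  · intro w
    by_contra! hall
    obtain ⟨z₀, h0⟩ := hsurj ⟨0, by simp⟩
    obtain ⟨z₁, h1⟩ := hsurj ⟨1, by simp⟩
    rw [hall] at h0 h1
    exact zero_ne_one (congrArg Subtype.val (h0.symm.trans h1))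

/-- The inverse of a Möbius transformation of the disk is one. -/
theorem exists_inverse {φ : ClosedDisk → ClosedDisk} (hφ : IsMobiusOfDisk φ) :
    ∃ ψ : ClosedDisk → ClosedDisk, IsMobiusOfDisk ψ ∧ Function.LeftInverse ψ φ := by
  obtain ⟨hsurj, a, b, c, d, hdet, h⟩ := hφ
  have hinj : Function.Injective φ := fun z w hzw => by
    have e := congrArg Subtype.val hzw
    rw [(h z).2, (h w).2, div_eq_div_iff (h z).1 (h w).1] at e
    refine Subtype.ext (mul_left_cancel₀ hdet ?_)
    linear_combination e
  obtain ⟨ψ, hl, hr⟩ := Function.bijective_iff_has_inverse.1 ⟨hinj, hsurj⟩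
  refine ⟨ψ, ⟨hl.surjective, d, -b, -c, a, fun h0 => hdet (by linear_combination h0),
    fun w => ?_⟩, hl⟩
  obtain ⟨z, rfl⟩ := hsurj w
  have hz := (h z).1
  have e : (φ z : ℂ) * (c * z + d) = a * z + b := by rw [(h z).2, div_mul_cancel₀ _ hz]
  have hne : -c * (φ z : ℂ) + a ≠ 0 := fun h0 => hdet (by
    linear_combination (c * (z : ℂ) + d) * h0 + c * e)
  refine ⟨hne, ?_⟩
  rw [hl z, eq_div_iff hne]
  linear_combination -e

/-- A translate of a rotated composition operator with a Möbius transformation is a surjective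
isometry. -/
theorem isometry_surjective {φ : ClosedDisk → ClosedDisk} (hφ : IsMobiusOfDisk φ) {α : ℂ}
    (hα : ‖α‖ = 1) {U : diskAlgebra → diskAlgebra} {u : diskAlgebra}
    (hU : ∀ f z, (U f).1 z = u.1 z + α * f.1 (φ z)) : Isometry U ∧ Function.Surjective U := by
  have hval : ∀ f g z, ‖(U f - U g).1 z‖ = ‖(f - g).1 (φ z)‖ := fun f g z => by
    rw [sub_apply, hU, hU, add_sub_add_left_eq_sub, ← mul_sub, norm_mul, hα, one_mul, sub_apply]
  refine ⟨Isometry.of_dist_eq fun f g => ?_, fun g => ?_⟩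
  · rw [dist_eq_norm, dist_eq_norm]
    refine le_antisymm (norm_le_of_apply (norm_nonneg _) fun z => ?_)
      (norm_le_of_apply (norm_nonneg _) fun w => ?_)
    · rw [hval]; exact norm_apply_le _ _
    · obtain ⟨z, rfl⟩ := hφ.1 w
      rw [← hval]; exact norm_apply_le _ _
  · have hα0 : α ≠ 0 := fun h0 => by simp [h0] at hα
    obtain ⟨ψ, hψ, hl⟩ := hφ.exists_inverse
    obtain ⟨f, hf⟩ := hψ.exists_comp (α⁻¹ • (g - u))
    refine ⟨f, ext_apply fun z => ?_⟩
    rw [hU, hf, hl, smul_apply, sub_apply, mul_inv_cancel_left₀ hα0, add_sub_cancel]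

end IsMobiusOfDisk

namespace DiskAlgebra

theorem conj_involutive : Function.Involutive conj := conj_conj

theorem isometry_conj : Isometry conj := by
  refine Isometry.of_dist_eq fun f g => ?_
  have hval : ∀ f g z, ‖(conj f - conj g).1 z‖ = ‖(f - g).1 (conjDisk z)‖ := fun f g z => by
    rw [sub_apply, conj_apply, conj_apply, ← map_sub, RCLike.norm_conj, sub_apply]
  rw [dist_eq_norm, dist_eq_norm]
  refine le_antisymm (norm_le_of_apply (norm_nonneg _) fun z => ?_)
    (norm_le_of_apply (norm_nonneg _) fun w => ?_)
  · rw [hval]; exact norm_apply_le _ _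
  · rw [← conjDisk_conjDisk w, ← hval]; exact norm_apply_le _ _

/-- The form of the surjective isometries of the disk algebra. -/
theorem exists_mobius_of_isometry {U : diskAlgebra → diskAlgebra} (hi : Isometry U)
    (hs : Function.Surjective U) :
    ∃ (φ : ClosedDisk → ClosedDisk) (α : ℂ), IsMobiusOfDisk φ ∧ ‖α‖ = 1 ∧
      ((∀ (f : diskAlgebra) (z : ClosedDisk), (U f).1 z = (U 0).1 z + α * f.1 (φ z)) ∨
       (∀ (f : diskAlgebra) (z : ClosedDisk),
          (U f).1 z = (U 0).1 z + α * (conj f).1 (φ z))) := by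
  let T : diskAlgebra ≃ₗᵢ[ℝ] diskAlgebra :=
    (IsometryEquiv.mk (Equiv.ofBijective U ⟨hi.injective, hs⟩) hi).toRealLinearIsometryEquiv
  have hT : ∀ f z, (U f).1 z = (U 0).1 z + (T f).1 z := fun f z => by
    have : T f = U f - U 0 := IsometryEquiv.toRealLinearIsometryEquiv_apply _ f
    rw [this, sub_apply, add_sub_cancel]
  rcases forall_apply_eq T with h | h
  · obtain ⟨φ, α, hφ, hα, hform⟩ := exists_mobius_of_forall_apply_eq T.bijective h
    exact ⟨φ, α, hφ, hα, Or.inl fun f z => by rw [hT, hform]⟩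
  · obtain ⟨φ, α, hφ, hα, hform⟩ := exists_mobius_of_forall_apply_eq
      (T := T ∘ conj) (T.bijective.comp conj_involutive.bijective) (fun y hy => by
        obtain ⟨x, β, hx, hβ, hf⟩ := h y hy
        refine ⟨conjDisk x, β, (RCLike.norm_conj _).trans hx, hβ, fun f => ?_⟩
        rw [Function.comp_apply, hf, conj_apply, Complex.conj_conj])
    refine ⟨φ, α, hφ, hα, Or.inr fun f z => ?_⟩
    rw [hT, ← hform, Function.comp_apply, conj_conj]

end DiskAlgebra

theorem mainTheorem11 :
    -- a self-map of the disk algebra is a surjective isometry iff it has one of the two forms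
    (∀ U : diskAlgebra → diskAlgebra,
      (Isometry U ∧ Function.Surjective U) ↔
        ∃ (φ : ClosedDisk → ClosedDisk) (α : ℂ), IsMobiusOfDisk φ ∧ ‖α‖ = 1 ∧
          ((∀ (f : diskAlgebra) (z : ClosedDisk),
              (U f).1 z = (U 0).1 z + α * f.1 (φ z)) ∨
           (∀ (f : diskAlgebra) (z : ClosedDisk),
              (U f).1 z = (U 0).1 z + α * starRingEnd ℂ (f.1 (conjDisk (φ z)))))) ∧
    -- and both forms do define self-maps of the disk algebra, for all choices of the data
    (∀ (φ : ClosedDisk → ClosedDisk) (α : ℂ) (u : diskAlgebra), IsMobiusOfDisk φ → ‖α‖ = 1 →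
      (∃ U : diskAlgebra → diskAlgebra, ∀ (f : diskAlgebra) (z : ClosedDisk),
          (U f).1 z = u.1 z + α * f.1 (φ z)) ∧
      (∃ U : diskAlgebra → diskAlgebra, ∀ (f : diskAlgebra) (z : ClosedDisk),
          (U f).1 z = u.1 z + α * starRingEnd ℂ (f.1 (conjDisk (φ z))))) := by
  refine ⟨fun U => ⟨fun h => DiskAlgebra.exists_mobius_of_isometry h.1 h.2, ?_⟩,
    fun φ α u hφ _ => ?_⟩
  · rintro ⟨φ, α, hφ, hα, h | h⟩
    · exact hφ.isometry_surjective hα h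
    · have hV := hφ.isometry_surjective hα (U := U ∘ DiskAlgebra.conj) (u := U 0) (fun f z => by
        rw [Function.comp_apply, h, ← DiskAlgebra.conj_apply, DiskAlgebra.conj_conj])
      have hUV : U = (U ∘ DiskAlgebra.conj) ∘ DiskAlgebra.conj :=
        funext fun f => by simp only [Function.comp_apply, DiskAlgebra.conj_conj]
      rw [hUV]
      exact ⟨hV.1.comp DiskAlgebra.isometry_conj,
        hV.2.comp DiskAlgebra.conj_involutive.surjective⟩
  · choose C hC using hφ.exists_comp
    exact ⟨⟨fun f => u + α • C f, fun f z => by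
        rw [DiskAlgebra.add_apply, DiskAlgebra.smul_apply, hC]⟩,
      ⟨fun f => u + α • C (DiskAlgebra.conj f), fun f z => by
        rw [DiskAlgebra.add_apply, DiskAlgebra.smul_apply, hC, DiskAlgebra.conj_apply]⟩⟩
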